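/- Work in the ring $\mathbb Z[[t]]$ of formal power series with the topology of coefficientwise convergence ($\mathbb Z$ discrete). A partition of $n\ge 0$ is a finite multiset of positive integers (its parts) with sum $n$. Let $p(n)$ be the number of partitions of $n$, and let $q(n)$ be the number of partitions of $n$ whose smallest part is greater than or equal to the number of parts; the empty partition of $0$ is counted, so $p(0)=q(0)=1$. Put $P(t)=\sum_{n\ge 0}p(n)t^n$ and $Q(t)=\sum_{n\ge 0}q(n)t^n$. Then all the infinite sums and products below converge in $\mathbb Z[[t]]$ (unconditionally), and the following hold. (a) (First Rogers--Ramanujan identity) $$1+\sum_{k=1}^\infty \frac{t^{k^2}}{(1-t)(1-t^2)\cdots(1-t^k)}=\prod_{i=0}^\infty\frac{1}{(1-t^{5i+1})(1-t^{5i+4})}.$$ (b) (Schur's identity) $$1+\sum_{k=1}^\infty \frac{t^{k^2}}{(1-t)(1-t^2)\cdots(1-t^k)}=\prod_{i=1}^\infty\frac{1}{1-t^i}\;\sum_{m=-\infty}^{\infty}(-1)^m t^{m(5m-1)/2}.$$ (c) In terms of partitions, $$P(t)=\prod_{i=1}^\infty\frac1{1-t^i},\qquad Q(t)=1+\sum_{k=1}^\infty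 \frac{t^{k^2}}{(1-t)(1-t^2)\cdots(1-t^k)},$$ and hence Schur's identity reads $$Q(t)=P(t)\sum_{m=-\infty}^{\infty}(-1)^m t^{m(5m-1)/2}.$$ -/

import Mathlib

open scoped PowerSeries PowerSeries.WithPiTopology

noncomputable section

/-- The reciprocal `1 / f` in `ℤ⟦t⟧` of a formal power series `f` with constant term `1`. -/
def RogersRamanujan.recip (f : ℤ⟦X⟧) : ℤ⟦X⟧ := PowerSeries.invOfUnit f 1

/-- `recip f` is indeed the inverse of `f` when the constant term of `f` is `1`. -/
theorem RogersRamanujan.mul_recip {f : ℤ⟦X⟧} (hf : PowerSeries.constantCoeff f = 1) :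
    f * RogersRamanujan.recip f = 1 :=
  PowerSeries.mul_invOfUnit f 1 (by simpa using hf)

/-- The term `t^(k^2) / ((1 - t)(1 - t^2) ⋯ (1 - t^k))`. -/
def RogersRamanujan.sumTerm (k : ℕ) : ℤ⟦X⟧ :=
  PowerSeries.X ^ (k ^ 2) *
    RogersRamanujan.recip (∏ i ∈ Finset.Icc 1 k, (1 - (PowerSeries.X : ℤ⟦X⟧) ^ i))

/-- The factor `1 / ((1 - t^(5i+1))(1 - t^(5i+4)))`. -/
def RogersRamanujan.prodFactor (i : ℕ) : ℤ⟦X⟧ :=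
  RogersRamanujan.recip
    ((1 - PowerSeries.X ^ (5 * i + 1)) * (1 - PowerSeries.X ^ (5 * i + 4)))

/-- The factor `1 / (1 - t^i)` (used for `i ≥ 1`). -/
def RogersRamanujan.eulerFactor (i : ℕ) : ℤ⟦X⟧ :=
  RogersRamanujan.recip (1 - PowerSeries.X ^ i)

/-- The term `(-1)^m t^(m(5m-1)/2)` for an integer `m`; the exponent is always a nonnegative
integer (see `schurExponent_spec`), so neither the division nor `toNat` loses anything. -/
def RogersRamanujan.schurTerm (m : ℤ) : ℤ⟦X⟧ :=
  (-1) ^ m.natAbs * PowerSeries.X ^ (m * (5 * m - 1) / 2).toNat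

theorem RogersRamanujan.schurExponent_spec (m : ℤ) :
    2 * ((m * (5 * m - 1) / 2).toNat : ℤ) = m * (5 * m - 1) := by
  have h2 : 2 ∣ m * (5 * m - 1) := by
    rcases Int.even_or_odd' m with ⟨k, rfl | rfl⟩
    · exact ⟨k * (5 * (2 * k) - 1), by ring⟩
    · exact ⟨(2 * k + 1) * (5 * k + 2), by ring⟩
  have h0 : 0 ≤ m * (5 * m - 1) := by
    rcases le_or_gt m 0 with h | h
    · nlinarith
    · nlinarith
  omega

/-- A Rogers–Ramanujan partition: its smallest part is at least its number of parts, that is,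
every part is at least the number of parts. The empty partition counts as one. -/
def RogersRamanujan.IsRogersRamanujan {n : ℕ} (p : n.Partition) : Prop :=
  ∀ a ∈ p.parts, Multiset.card p.parts ≤ a

/-- `P(t) = ∑ p(n) t^n`, with `p(n)` the number of partitions of `n`. -/
def RogersRamanujan.P : ℤ⟦X⟧ := PowerSeries.mk fun n => (Nat.card n.Partition : ℤ)

/-- `Q(t) = ∑ q(n) t^n`, with `q(n)` the number of Rogers–Ramanujan partitions of `n`. -/
def RogersRamanujan.Q : ℤ⟦X⟧ := PowerSeries.mk fun n =>
  (Nat.card {p : n.Partition // RogersRamanujan.IsRogersRamanujan p} : ℤ)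

end

/-! The proof passes to the limit in finite identities. Let `r n` be the reciprocal of `(1 - q) ⋯ (1
- q ^ n)`, extended by zero to negative `n`. A `q`-Vandermonde summation gives Bailey's lemma
(`bailey`): a factor `q ^ (j ^ 2)` inside a sum against `r (N - j) * r (N + j)` can be traded for an
outer sum over `s` weighted by `q ^ (s ^ 2) * r (N - s)`.

Since `j(5j-1)/2 = j² + j² + j(j-1)/2`, two applications reduce the Schur sum to the weights `(-1)^j
q^(j(j-1)/2)`, whose sum vanishes unless `N = 0` (`finsum_orthogonality`). This is `schur_finite`;
letting `N → ∞` and cancelling one factor `∏ 1/(1 - t^i)` gives Schur's identity.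

The product side is the finite Jacobi triple product with `q = t^5`, `z = t^2` (`finsum_schurTerm`),
combined with sorting the factors `1 - t^i` by `i` mod 5. The same recursion `finsum_succ` yields
the triple product and, at `z = 1`, the orthogonality.

For `Q`, subtracting `k` from each part of a partition with `k` parts, all at least `k`, removes
`k^2` and leaves an arbitrary multiset of `k` natural numbers. -/

namespace RogersRamanujan

/-! ### Bailey's lemma and the triple product recursion over a commutative ring -/

section Algebra

variable {R : Type*} [CommRing R]

/-- `r n` is the reciprocal of the `q`-Pochhammer symbol `(1 - q)(1 - q ^ 2) ⋯ (1 - q ^ n)`,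
extended by `0` to negative `n`. -/
structure IsInvPochhammer (q : R) (r : ℤ → R) : Prop where
  isUnit (n : ℕ) : IsUnit (1 - q ^ (n + 1))
  zero : r 0 = 1
  neg (n : ℤ) : n < 0 → r n = 0
  succ (n : ℕ) : (1 - q ^ (n + 1)) * r (n + 1) = r n

namespace IsInvPochhammer

variable {q : R} {r : ℤ → R}

/-- Extension by zero keeps the recursion valid at every integer: at `n = 0` it reads `0 = 0`
because `1 - q ^ 0 = 0`. -/
theorem mul_self (hr : IsInvPochhammer q r) (n : ℤ) : (1 - q ^ n.toNat) * r n = r (n - 1) := by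
  rcases lt_trichotomy n 0 with h | rfl | h
  · rw [hr.neg n h, hr.neg _ (by omega), mul_zero]
  · simp [hr.neg (-1) (by omega)]
  · obtain ⟨m, rfl⟩ : ∃ m : ℕ, n = m + 1 := ⟨(n - 1).toNat, by omega⟩
    have : ((m : ℤ) + 1).toNat = m + 1 := by omega
    rw [this, hr.succ, add_sub_cancel_right]

/-- A limiting case of the `q`-Chu–Vandermonde summation. -/
theorem vandermonde (hr : IsInvPochhammer q r) (M : ℕ) : ∀ c : ℕ,
    ∑ u ∈ Finset.range (M + 1), q ^ (u * (u + c)) * r (M - u) * r u * r (u + c) =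
      r M * r (M + c) := by
  induction M with
  | zero => intro c; simp [hr.zero]
  | succ M ih =>
    intro c
    refine (hr.isUnit M).mul_left_cancel ?_
    -- Split `1 - q^(M+1) = (1 - q^(M+1-u)) + q^(M+1-u) (1 - q^u)`: the first piece lowers `r (M + 1
    -- - u)`, the second lowers `r u`. They sum to the induction hypothesis at `c` and, after
    -- shifting `u`, at `c + 1`.
    have key : ∀ u ∈ Finset.range (M + 1 + 1),
        (1 - q ^ (M + 1)) *
          (q ^ (u * (u + c)) * r ((M + 1 : ℕ) - u) * r u * r (u + c)) =
        q ^ (u * (u + c)) * r (M - u) * r u * r (u + c) +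
          q ^ (u * (u + c)) * q ^ (M + 1 - u) * r (M + 1 - u) * r (u - 1) * r (u + c) := by
      intro u hu
      have hu' : u ≤ M + 1 := by simpa [Nat.lt_succ_iff] using hu
      have h1 := hr.mul_self ((M : ℤ) + 1 - u)
      have h2 := hr.mul_self (u : ℤ)
      rw [show ((M : ℤ) + 1 - u).toNat = M + 1 - u by omega,
        show (M : ℤ) + 1 - u - 1 = M - u by ring] at h1
      rw [Int.toNat_natCast] at h2
      have h3 : q ^ (M + 1) = q ^ (M + 1 - u) * q ^ u := by rw [← pow_add]; congr 1; omega
      rw [h3, ← h1, ← h2]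
      push_cast
      ring
    rw [Finset.mul_sum, Finset.sum_congr rfl key, Finset.sum_add_distrib,
      Finset.sum_range_succ, Finset.sum_range_succ' _ (M + 1)]
    have e1 : r ((M : ℤ) - (M + 1 : ℕ)) = 0 := hr.neg _ (by push_cast; omega)
    have e2 : r (((0 : ℕ) : ℤ) - 1) = 0 := hr.neg _ (by simp)
    have e3 : ∑ k ∈ Finset.range (M + 1), q ^ ((k + 1) * (k + 1 + c)) * q ^ (M + 1 - (k + 1)) *
          r (M + 1 - (k + 1 : ℕ)) * r ((k + 1 : ℕ) - 1) * r ((k + 1 : ℕ) + c) =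
        q ^ (M + 1 + c) * (r M * r (M + (c + 1 : ℕ))) := by
      rw [← ih (c + 1), Finset.mul_sum]
      refine Finset.sum_congr rfl fun k hk => ?_
      have hk' : k ≤ M := by simpa [Nat.lt_succ_iff] using hk
      have : q ^ ((k + 1) * (k + 1 + c)) * q ^ (M + 1 - (k + 1)) =
          q ^ (M + 1 + c) * q ^ (k * (k + (c + 1))) := by
        rw [← pow_add, ← pow_add]
        congr 1
        obtain ⟨d, rfl⟩ := Nat.exists_eq_add_of_le hk'
        rw [show k + d + 1 - (k + 1) = d by omega]
        ring
      rw [this]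
      push_cast
      rw [show (M : ℤ) + 1 - (k + 1) = M - k by ring, show (k : ℤ) + 1 - 1 = k by ring,
        show (k : ℤ) + 1 + c = k + (c + 1) by ring]
      ring
    rw [e3, ih c, e1, e2]
    have h4 := hr.succ M
    have h5 := hr.succ (M + c)
    push_cast at h5 ⊢
    rw [← mul_assoc (1 - q ^ (M + 1)), h4, show (M : ℤ) + 1 + c = M + c + 1 by ring,
      show (M : ℤ) + (c + 1) = M + c + 1 by ring, ← h5]
    ring

/-- For `j ≥ 0` only `s ≥ j` contributes, and `s = j + u` turns this into `vandermonde` with `M = N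
- j`, `c = 2j`; the case `j < 0` follows by symmetry. -/
theorem sum_sq_mul (hr : IsInvPochhammer q r) (N : ℕ) (j : ℤ) :
    ∑ s ∈ Finset.range (N + 1), q ^ (s ^ 2) * r (N - s) * (r (s - j) * r (s + j)) =
      q ^ (j.natAbs ^ 2) * (r (N - j) * r (N + j)) := by
  wlog hj : 0 ≤ j generalizing j
  · have := this (-j) (by omega)
    simp only [Int.natAbs_neg, sub_neg_eq_add, ← sub_eq_add_neg] at this
    rw [mul_comm (r (N - j)), ← this]
    exact Finset.sum_congr rfl fun s _ => by ring
  obtain ⟨k, rfl⟩ := Int.eq_ofNat_of_zero_le hj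
  rw [Int.natAbs_natCast]
  rcases lt_or_ge N k with h | h
  · rw [hr.neg (N - k) (by omega)]
    simp only [zero_mul, mul_zero]
    refine Finset.sum_eq_zero fun s hs => ?_
    rw [hr.neg (s - k) (by simp at hs; omega)]
    ring
  · obtain ⟨M, rfl⟩ := Nat.exists_eq_add_of_le h
    have hv := hr.vandermonde M (2 * k)
    rw [add_assoc k M 1, Finset.sum_range_add, Finset.sum_eq_zero, zero_add]
    · rw [show ((k + M : ℕ) : ℤ) - k = M by push_cast; ring,
        show ((k + M : ℕ) : ℤ) + k = M + (2 * k : ℕ) by push_cast; ring, ← hv, Finset.mul_sum]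
      refine Finset.sum_congr rfl fun u _ => ?_
      push_cast
      rw [show (k : ℤ) + M - (k + u) = M - u by ring, show (k : ℤ) + u - k = u by ring,
        show (k : ℤ) + u + k = u + 2 * k by ring,
        show (k + u) ^ 2 = k ^ 2 + u * (u + 2 * k) by ring, pow_add]
      ring
    · intro s hs
      rw [hr.neg (s - k) (by simp at hs; omega)]
      ring

/-- A limiting case of Bailey's lemma. -/
theorem bailey (hr : IsInvPochhammer q r) (α : ℤ → R) (J : Finset ℤ) (N : ℕ) :
    ∑ j ∈ J, q ^ (j.natAbs ^ 2) * α j * (r (N - j) * r (N + j)) =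
      ∑ s ∈ Finset.range (N + 1), q ^ (s ^ 2) * r (N - s) *
        ∑ j ∈ J, α j * (r (s - j) * r (s + j)) := by
  simp_rw [Finset.mul_sum]
  rw [Finset.sum_comm]
  refine Finset.sum_congr rfl fun j _ => ?_
  rw [mul_right_comm, ← hr.sum_sq_mul N j, Finset.sum_mul]
  exact Finset.sum_congr rfl fun s _ => by ring

theorem support_subset (hr : IsInvPochhammer q r) (w : ℤ → R) (N : ℤ) :
    Function.support (fun j => w j * (r (N - j) * r (N + j))) ⊆ Finset.Icc (-N) N := by
  intro j hj
  by_contra h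
  simp only [Finset.coe_Icc, Set.mem_Icc, not_and_or, not_le] at h
  apply hj
  rcases h with h | h
  · simp [hr.neg (N + j) (by omega)]
  · simp [hr.neg (N - j) (by omega)]

/-- The recursion step for the finite form of the Jacobi triple product. -/
theorem finsum_succ (hr : IsInvPochhammer q r) (w : ℤ → R) (N : ℕ) (A B : R)
    (hA : ∀ j : ℤ, j ≤ N + 1 → A * w (j - 1) = -(w j * q ^ (N + 1 - j).toNat))
    (hB : ∀ j : ℤ, -(N + 1) ≤ j → B * w (j + 1) = -(w j * q ^ (N + 1 + j).toNat))
    (hAB : A * B = q ^ (2 * N + 1)) :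
    (1 - A) * (1 - B) * ∑ᶠ j : ℤ, w j * (r (N - j) * r (N + j)) =
      (1 - q ^ (2 * N + 1)) * (1 - q ^ (2 * N + 2)) *
        ∑ᶠ j : ℤ, w j * (r ((N + 1 : ℤ) - j) * r ((N + 1 : ℤ) + j)) := by
  set f : ℤ → R := fun j => w j * (r (N - j) * r (N + j)) with hf
  have hs := hr.support_subset w N
  have h0 : ∑ᶠ j, f j = ∑ j ∈ Finset.Icc (-(N + 1) : ℤ) (N + 1), f j :=
    finsum_eq_sum_of_support_subset _ (hs.trans (by
      rw [Finset.coe_subset]; exact Finset.Icc_subset_Icc (by omega) (by omega)))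
  have h1 : ∑ᶠ j, f j = ∑ j ∈ Finset.Icc (-(N + 1) : ℤ) (N + 1), f (j - 1) := by
    rw [← finsum_comp_equiv (Equiv.subRight (1 : ℤ))]
    refine finsum_eq_sum_of_support_subset _ fun j hj => ?_
    have := hs (show j - 1 ∈ Function.support f from hj)
    simp only [Finset.coe_Icc, Set.mem_Icc] at this ⊢
    omega
  have h2 : ∑ᶠ j, f j = ∑ j ∈ Finset.Icc (-(N + 1) : ℤ) (N + 1), f (j + 1) := by
    rw [← finsum_comp_equiv (Equiv.addRight (1 : ℤ))]
    refine finsum_eq_sum_of_support_subset _ fun j hj => ?_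
    have := hs (show j + 1 ∈ Function.support f from hj)
    simp only [Finset.coe_Icc, Set.mem_Icc] at this ⊢
    omega
  -- Expand `(1 - A)(1 - B)` and shift `j` by one in the `A` and `B` terms; every summand is then a
  -- multiple of `w j * r (N + 1 - j) * r (N + 1 + j)`, so the sums can be compared term by term.
  rw [finsum_eq_sum_of_support_subset _ (hr.support_subset w (N + 1)),
    show (1 - A) * (1 - B) * ∑ᶠ j, f j = (1 + q ^ (2 * N + 1)) * ∑ᶠ j, f j
      - A * ∑ᶠ j, f j - B * ∑ᶠ j, f j by rw [← hAB]; ring]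
  nth_rw 1 [h0]
  nth_rw 1 [h1]
  rw [h2]
  simp only [Finset.mul_sum]
  rw [← Finset.sum_sub_distrib, ← Finset.sum_sub_distrib]
  refine Finset.sum_congr rfl fun j hj => ?_
  rw [Finset.mem_Icc] at hj
  have a1 := hr.mul_self (N + 1 - j)
  have a2 := hr.mul_self (N - j)
  have b1 := hr.mul_self (N + 1 + j)
  have b2 := hr.mul_self (N + j)
  rw [show (N : ℤ) + 1 - j - 1 = N - j by ring] at a1
  rw [show (N : ℤ) + 1 + j - 1 = N + j by ring] at b1
  have hA' := hA j hj.2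
  have hB' := hB j hj.1
  simp only [hf]
  rw [show (N : ℤ) - (j - 1) = N + 1 - j by ring, show (N : ℤ) + (j - 1) = N + j - 1 by ring,
    show (N : ℤ) - (j + 1) = N - j - 1 by ring, show (N : ℤ) + (j + 1) = N + 1 + j by ring,
    ← a2, ← b2, ← a1, ← b1]
  have c1 : q ^ (N + 1 - j).toNat * q ^ (N + 1 + j).toNat = q ^ (2 * N + 2) := by
    rw [← pow_add]; congr 1; omega
  -- At `j = -(N + 1)` the exponent `N + j` is negative and truncated, but the retained factor `1 -
  -- q ^ 0` vanishes there; likewise in `c3` at `j = N + 1`.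
  have c2 : (1 - q ^ (N + 1 + j).toNat) * (q ^ (N + 1 - j).toNat * q ^ (N + j).toNat) =
      (1 - q ^ (N + 1 + j).toNat) * q ^ (2 * N + 1) := by
    rcases eq_or_lt_of_le hj.1 with h | h
    · rw [show (N + 1 + j).toNat = 0 by omega]; simp
    · rw [← pow_add]; congr 2; omega
  have c3 : (1 - q ^ (N + 1 - j).toNat) * (q ^ (N + 1 + j).toNat * q ^ (N - j).toNat) =
      (1 - q ^ (N + 1 - j).toNat) * q ^ (2 * N + 1) := by
    rcases eq_or_lt_of_le hj.2 with h | h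
    · rw [show (N + 1 - j).toNat = 0 by omega]; simp
    · rw [← pow_add]; congr 2; omega
  generalize q ^ (N + 1 - j).toNat = a at *
  generalize q ^ (N + 1 + j).toNat = b at *
  generalize q ^ (N - j).toNat = a' at *
  generalize q ^ (N + j).toNat = b' at *
  generalize r (N + 1 - j) = x at *
  generalize r (N + 1 + j) = y at *
  generalize q ^ (2 * N + 1) = u at *
  generalize q ^ (2 * N + 2) = v at *
  linear_combination (-(1 - b') * (1 - b) * x * y) * hA' - (1 - a') * (1 - a) * x * y * hB'
    + (w j * x * y) * (-c2 - c3) + (w j * x * y) * (u - 1) * c1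

end IsInvPochhammer

end Algebra

theorem neg_one_pow_natAbs_add_one {R : Type*} [Ring R] (j : ℤ) :
    (-1 : R) ^ (j + 1).natAbs = -(-1) ^ j.natAbs := by
  rcases Int.even_or_odd j with h | h
  · rw [(Int.natAbs_even.mpr h).neg_one_pow, (Int.natAbs_odd.mpr h.add_one).neg_one_pow]
  · rw [(Int.natAbs_odd.mpr h).neg_one_pow, (Int.natAbs_even.mpr h.add_one).neg_one_pow, neg_neg]

theorem neg_one_pow_natAbs_sub_one {R : Type*} [Ring R] (j : ℤ) :
    (-1 : R) ^ (j - 1).natAbs = -(-1) ^ j.natAbs := by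
  have := neg_one_pow_natAbs_add_one (R := R) (j - 1)
  rw [sub_add_cancel] at this
  rw [this, neg_neg]

theorem two_mul_toNat_choose (j : ℤ) : 2 * ((j * (j - 1) / 2).toNat : ℤ) = j * (j - 1) := by
  have h2 : 2 ∣ j * (j - 1) := (Int.even_mul_pred_self j).two_dvd
  have h0 : 0 ≤ j * (j - 1) := by
    rcases le_or_gt j 0 with h | h <;> nlinarith
  omega

/-! ### Orthogonality and the finite Schur identity -/

namespace IsInvPochhammer

variable {R : Type*} [CommRing R] {q : R} {r : ℤ → R}

theorem finsum_zero (hr : IsInvPochhammer q r) (w : ℤ → R) (hw : w 0 = 1) :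
    ∑ᶠ j : ℤ, w j * (r (0 - j) * r (0 + j)) = 1 := by
  rw [finsum_eq_sum_of_support_subset _ (hr.support_subset w 0)]
  simp [hw, hr.zero]

theorem finsum_orthogonality (hr : IsInvPochhammer q r) (N : ℕ) :
    ∑ᶠ j : ℤ, (-1) ^ j.natAbs * q ^ (j * (j - 1) / 2).toNat * (r (N - j) * r (N + j)) =
      if N = 0 then 1 else 0 := by
  induction N with
  | zero => simpa using hr.finsum_zero (fun j => (-1) ^ j.natAbs * q ^ (j * (j - 1) / 2).toNat) (by simp)
  | succ N ih =>
    have h := hr.finsum_succ (fun j => (-1) ^ j.natAbs * q ^ (j * (j - 1) / 2).toNat) N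
      (q ^ N) (q ^ (N + 1)) (fun j hj => ?_) (fun j hj => ?_) (by ring)
    · rw [if_neg N.succ_ne_zero]
      push_cast
      refine ((hr.isUnit (2 * N)).mul (hr.isUnit (2 * N + 1))).mul_left_cancel ?_
      rw [← h, ih, mul_zero]
      -- In passing from `0` to `1` the factor `1 - q ^ 0` kills the sum; afterwards the recursion
      -- propagates zero.
      rcases N with _ | N <;> simp
    · have e : N + ((j - 1) * (j - 1 - 1) / 2).toNat =
          (j * (j - 1) / 2).toNat + (N + 1 - j).toNat := by
        have h1 := two_mul_toNat_choose j
        have h2 := two_mul_toNat_choose (j - 1)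
        zify
        rw [Int.toNat_of_nonneg (a := N + 1 - j) (by omega)]
        linarith
      simp only [neg_one_pow_natAbs_sub_one]
      linear_combination (-(-1) ^ j.natAbs) * congrArg (q ^ ·) e
    · have e : N + 1 + ((j + 1) * (j + 1 - 1) / 2).toNat =
          (j * (j - 1) / 2).toNat + (N + 1 + j).toNat := by
        have h1 := two_mul_toNat_choose j
        have h2 := two_mul_toNat_choose (j + 1)
        zify
        rw [Int.toNat_of_nonneg (a := N + 1 + j) (by omega)]
        linarith
      simp only [neg_one_pow_natAbs_add_one]
      linear_combination (-(-1) ^ j.natAbs) * congrArg (q ^ ·) e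

theorem sum_orthogonality (hr : IsInvPochhammer q r) {N M : ℕ} (h : N ≤ M) :
    ∑ j ∈ Finset.Icc (-M : ℤ) M,
      (-1) ^ j.natAbs * q ^ (j * (j - 1) / 2).toNat * (r (N - j) * r (N + j)) =
      if N = 0 then 1 else 0 := by
  rw [← hr.finsum_orthogonality N]
  refine (finsum_eq_sum_of_support_subset _ ((hr.support_subset _ N).trans ?_)).symm
  rw [Finset.coe_subset]
  exact Finset.Icc_subset_Icc (by omega) (by omega)

/-- The finite form of Schur's identity. -/
theorem schur_finite (hr : IsInvPochhammer q r) (N : ℕ) :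
    ∑ j ∈ Finset.Icc (-N : ℤ) N,
      (-1) ^ j.natAbs * q ^ (j * (5 * j - 1) / 2).toNat * (r (N - j) * r (N + j)) =
      ∑ s ∈ Finset.range (N + 1), q ^ (s ^ 2) * r (N - s) * r s := by
  have e (j : ℤ) : (-1) ^ j.natAbs * q ^ (j * (5 * j - 1) / 2).toNat =
      q ^ (j.natAbs ^ 2) * (q ^ (j.natAbs ^ 2) *
        ((-1) ^ j.natAbs * q ^ (j * (j - 1) / 2).toNat)) := by
    have : (j * (5 * j - 1) / 2).toNat =
        j.natAbs ^ 2 + (j.natAbs ^ 2 + (j * (j - 1) / 2).toNat) := by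
      have h1 := two_mul_toNat_choose j
      have h2 := schurExponent_spec j
      zify
      rw [sq_abs]
      linarith
    rw [this, pow_add, pow_add]
    ring
  simp_rw [e]
  rw [hr.bailey]
  refine Finset.sum_congr rfl fun s hs => ?_
  rw [hr.bailey, Finset.sum_eq_single 0]
  · rw [hr.sum_orthogonality (Nat.zero_le N)]
    simp
  · intro t ht ht0
    rw [hr.sum_orthogonality (by simp at hs ht; omega), if_neg ht0, mul_zero]
  · simp

end IsInvPochhammer

/-! ### Finite products in `ℤ⟦t⟧` with bases `t` and `t^5` -/

section Concrete

open PowerSeries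

theorem recip_mul {f : ℤ⟦X⟧} (hf : constantCoeff f = 1) : recip f * f = 1 := by
  rw [mul_comm, mul_recip hf]

theorem eq_recip {f g : ℤ⟦X⟧} (hf : constantCoeff f = 1) (h : f * g = 1) : g = recip f := by
  rw [← one_mul g, ← recip_mul hf, mul_assoc, h, mul_one]

theorem constantCoeff_one_sub_X_pow {m : ℕ} (hm : m ≠ 0) :
    constantCoeff (1 - X ^ m : ℤ⟦X⟧) = 1 := by
  simp [hm]

theorem one_sub_X_pow_mul_eulerFactor {m : ℕ} (hm : m ≠ 0) :
    (1 - X ^ m : ℤ⟦X⟧) * eulerFactor m = 1 :=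
  mul_recip (constantCoeff_one_sub_X_pow hm)

/-- The reciprocal of `(1 - t ^ k) (1 - t ^ (2 k)) ⋯ (1 - t ^ (n k))`. -/
noncomputable def invPoch (k : ℕ) (n : ℤ) : ℤ⟦X⟧ :=
  if n < 0 then 0 else ∏ i ∈ Finset.range n.toNat, eulerFactor (k * (i + 1))

theorem invPoch_natCast (k n : ℕ) :
    invPoch k n = ∏ i ∈ Finset.range n, eulerFactor (k * (i + 1)) := by
  simp [invPoch]

theorem isInvPochhammer_invPoch {k : ℕ} (hk : k ≠ 0) :
    IsInvPochhammer (X ^ k : ℤ⟦X⟧) (invPoch k) where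
  isUnit n := by
    rw [← pow_mul]
    exact IsUnit.of_mul_eq_one _ (one_sub_X_pow_mul_eulerFactor (by positivity))
  zero := by simp [invPoch]
  neg n hn := if_pos hn
  succ n := by
    rw [← pow_mul]
    have := invPoch_natCast k (n + 1)
    push_cast at this
    rw [this, invPoch_natCast, Finset.prod_range_succ, mul_left_comm,
      one_sub_X_pow_mul_eulerFactor (by positivity), mul_one]

theorem sumTerm_eq (k : ℕ) : sumTerm k = X ^ (k ^ 2) * invPoch 1 k := by
  rw [sumTerm, invPoch_natCast]
  congr 1
  refine (eq_recip ?_ ?_).symm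
  · rw [map_prod]
    exact Finset.prod_eq_one fun i hi => constantCoeff_one_sub_X_pow (by simp at hi; omega)
  · rw [← Finset.Ico_add_one_right_eq_Icc, Finset.prod_Ico_eq_prod_range, Nat.add_sub_cancel, ← Finset.prod_mul_distrib]
    refine Finset.prod_eq_one fun i _ => ?_
    rw [one_mul, add_comm]
    exact one_sub_X_pow_mul_eulerFactor (by omega)

/-- The finite form of the Jacobi triple product, for `∏ (1 - t^(5k+2)) (1 - t^(5k+3))`. -/
theorem finsum_schurTerm (N : ℕ) :
    ∑ᶠ j : ℤ, schurTerm j * (invPoch 5 (N - j) * invPoch 5 (N + j)) =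
      invPoch 5 (2 * N) *
        ∏ k ∈ Finset.range N, ((1 - X ^ (5 * k + 2)) * (1 - X ^ (5 * k + 3))) := by
  have hr := isInvPochhammer_invPoch (k := 5) (by norm_num)
  induction N with
  | zero => simpa [hr.zero] using hr.finsum_zero schurTerm (by simp [schurTerm])
  | succ N ih =>
    have h := hr.finsum_succ schurTerm N (X ^ (5 * N + 2)) (X ^ (5 * N + 3))
      (fun j hj => ?_) (fun j hj => ?_) (by ring)
    · refine ((hr.isUnit (2 * N)).mul (hr.isUnit (2 * N + 1))).mul_left_cancel ?_
      push_cast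
      rw [← h, ih, Finset.prod_range_succ]
      have s1 := hr.succ (2 * N)
      have s2 := hr.succ (2 * N + 1)
      push_cast at s1 s2
      rw [show 2 * ((N : ℤ) + 1) = 2 * N + 1 + 1 by ring]
      rw [← s1, ← s2]
      ring
    · have e : 5 * N + 2 + ((j - 1) * (5 * (j - 1) - 1) / 2).toNat =
          (j * (5 * j - 1) / 2).toNat + 5 * (N + 1 - j).toNat := by
        have h1 := schurExponent_spec j
        have h2 := schurExponent_spec (j - 1)
        zify
        rw [Int.toNat_of_nonneg (a := N + 1 - j) (by omega)]
        linarith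
      simp only [schurTerm, neg_one_pow_natAbs_sub_one]
      rw [← pow_mul]
      linear_combination (-(-1) ^ j.natAbs) * congrArg ((X : ℤ⟦X⟧) ^ ·) e
    · have e : 5 * N + 3 + ((j + 1) * (5 * (j + 1) - 1) / 2).toNat =
          (j * (5 * j - 1) / 2).toNat + 5 * (N + 1 + j).toNat := by
        have h1 := schurExponent_spec j
        have h2 := schurExponent_spec (j + 1)
        zify
        rw [Int.toNat_of_nonneg (a := N + 1 + j) (by omega)]
        linarith
      simp only [schurTerm, neg_one_pow_natAbs_add_one]
      rw [← pow_mul]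
      linear_combination (-(-1) ^ j.natAbs) * congrArg ((X : ℤ⟦X⟧) ^ ·) e

theorem mul_prodFactor (i : ℕ) :
    (1 - X ^ (5 * i + 1)) * (1 - X ^ (5 * i + 4)) * prodFactor i = 1 :=
  mul_recip (by simp)

/-- The factors `1 - t^i` with `i ≤ 5N` are sorted by residue: multiples of 5, residues 1 and 4,
residues 2 and 3. -/
theorem invPoch_mul_prod_prodFactor (N : ℕ) :
    invPoch 5 N * ∏ k ∈ Finset.range N, prodFactor k =
      invPoch 1 (5 * N) *
        ∏ k ∈ Finset.range N, ((1 - X ^ (5 * k + 2)) * (1 - X ^ (5 * k + 3))) := by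
  have h5 := isInvPochhammer_invPoch (k := 5) (by norm_num)
  have h1 := isInvPochhammer_invPoch (k := 1) (by norm_num)
  induction N with
  | zero => simp [h5.zero, h1.zero]
  | succ N ih =>
    have s := h5.succ N
    have t0 := h1.succ (5 * N)
    have t1 := h1.succ (5 * N + 1)
    have t2 := h1.succ (5 * N + 2)
    have t3 := h1.succ (5 * N + 3)
    have t4 := h1.succ (5 * N + 4)
    have hp := mul_prodFactor N
    refine (h5.isUnit N).mul_left_cancel ?_
    rw [Finset.prod_range_succ, Finset.prod_range_succ]
    push_cast at *
    rw [show 5 * ((N : ℤ) + 1) = 5 * N + 4 + 1 by ring]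
    rw [show (5 * N + 1 + 1 : ℤ) = 5 * N + 2 by ring] at t1
    rw [show (5 * N + 2 + 1 : ℤ) = 5 * N + 3 by ring] at t2
    rw [show (5 * N + 3 + 1 : ℤ) = 5 * N + 4 by ring] at t3
    have e : (X ^ 5 : ℤ⟦X⟧) ^ (N + 1) = (X ^ 1) ^ (5 * N + 4 + 1) := by ring
    rw [← mul_assoc, s, ← mul_assoc, ih, e]
    simp only [← t0, ← t1, ← t2, ← t3, ← mul_assoc]
    simp only [pow_one] at *
    linear_combination (∏ x ∈ Finset.range N, (1 - X ^ (5 * x + 2)) * (1 - X ^ (5 * x + 3))) *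
      (1 - X ^ (5 * N + 2)) * (1 - X ^ (5 * N + 3)) * (invPoch 1 (5 * N + 4)) * hp -
      (∏ x ∈ Finset.range N, (1 - X ^ (5 * x + 2)) * (1 - X ^ (5 * x + 3))) *
      (1 - X ^ (5 * N + 2)) * (1 - X ^ (5 * N + 3)) * t4

end Concrete

open PowerSeries Filter Topology WithPiTopology

/-! ### Convergence and passage to the limit -/

section Limits

variable {ι : Type*}

theorem summable_of_X_pow_dvd {h : ι → ℕ} (hh : ∀ d, {i | h i ≤ d}.Finite) {f : ι → ℤ⟦X⟧}
    (hf : ∀ i, X ^ h i ∣ f i) : Summable f := by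
  rw [summable_iff_summable_coeff]
  refine fun d => summable_of_hasFiniteSupport ((hh d).subset fun i hi => ?_)
  by_contra hlt
  exact hi (X_pow_dvd_iff.mp (hf i) d (not_le.mp hlt))

theorem coeff_tsum_of_X_pow_dvd {h : ι → ℕ} (hh : ∀ d, {i | h i ≤ d}.Finite) {f : ι → ℤ⟦X⟧}
    (hf : ∀ i, X ^ h i ∣ f i) (d : ℕ) :
    coeff d (∑' i, f i) = ∑ i ∈ (hh d).toFinset, coeff d (f i) := by
  rw [(summable_of_X_pow_dvd hh hf).map_tsum _ (continuous_coeff ℤ d), tsum_eq_sum]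
  intro i hi
  exact X_pow_dvd_iff.mp (hf i) d (by simpa using hi)

/-- Tannery's theorem for formal power series. -/
theorem tendsto_tsum_of_X_pow_dvd {h : ι → ℕ} (hh : ∀ d, {i | h i ≤ d}.Finite)
    {F : ℕ → ι → ℤ⟦X⟧} {f : ι → ℤ⟦X⟧} (hF : ∀ N i, X ^ h i ∣ F N i)
    (hlim : ∀ i, Tendsto (F · i) atTop (𝓝 (f i))) :
    Tendsto (fun N => ∑' i, F N i) atTop (𝓝 (∑' i, f i)) := by
  have hf (i : ι) : X ^ h i ∣ f i := by
    refine X_pow_dvd_iff.mpr fun m hm => ?_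
    refine tendsto_nhds_unique ((tendsto_iff_coeff_tendsto ℤ _ _ _).mp (hlim i) m) ?_
    simp [X_pow_dvd_iff.mp (hF _ i) m hm]
  rw [tendsto_iff_coeff_tendsto]
  intro d
  simp_rw [coeff_tsum_of_X_pow_dvd hh (hF _), coeff_tsum_of_X_pow_dvd hh hf]
  exact tendsto_finsetSum _ fun i _ => (tendsto_iff_coeff_tendsto ℤ _ _ _).mp (hlim i) d

theorem finite_natAbs_le (d : ℕ) : {m : ℤ | m.natAbs ≤ d}.Finite :=
  (Set.finite_Icc (-d : ℤ) d).subset fun m hm => by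
    simp only [Set.mem_ofPred_eq, Set.mem_Icc] at hm ⊢
    omega

theorem multipliable_of_X_pow_dvd {f : ℕ → ℤ⟦X⟧} (hf : ∀ i, X ^ i ∣ f i - 1) :
    Multipliable f := by
  have : Multipliable fun i => 1 + (f i - 1) := by
    refine multipliable_one_add_of_tendsto_order_atTop_nhds_top ℤ ?_
    refine ENat.tendsto_nhds_top_iff_natCast_lt.mpr fun n => ?_
    filter_upwards [eventually_gt_atTop n] with m hm
    exact lt_of_lt_of_le (Nat.cast_lt.mpr hm) (le_order _ m fun i hi =>
      X_pow_dvd_iff.mp (hf m) i (Nat.cast_lt.mp hi))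
  simpa using this

theorem X_pow_dvd_recip_sub_one {f : ℤ⟦X⟧} {n : ℕ} (hf : constantCoeff f = 1)
    (h : X ^ n ∣ f - 1) : X ^ n ∣ recip f - 1 := by
  have : recip f - 1 = -(recip f) * (f - 1) := by linear_combination recip_mul hf
  rw [this]
  exact h.mul_left _

theorem X_pow_dvd_eulerFactor_sub_one {n m : ℕ} (hm : m ≠ 0) (h : n ≤ m) :
    X ^ n ∣ eulerFactor m - 1 := by
  refine X_pow_dvd_recip_sub_one (constantCoeff_one_sub_X_pow hm) ?_
  rw [sub_sub_cancel_left]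
  exact (pow_dvd_pow _ h).neg_right

theorem multipliable_eulerFactor {k : ℕ} (hk : k ≠ 0) :
    Multipliable fun i => eulerFactor (k * (i + 1)) :=
  multipliable_of_X_pow_dvd fun i => X_pow_dvd_eulerFactor_sub_one (by positivity) (by
    have : 1 * (i + 1) ≤ k * (i + 1) := Nat.mul_le_mul_right _ (Nat.one_le_iff_ne_zero.mpr hk)
    omega)

theorem multipliable_prodFactor : Multipliable prodFactor := by
  refine multipliable_of_X_pow_dvd fun i => X_pow_dvd_recip_sub_one (by simp) ?_
  exact ⟨X ^ (9 * i + 5) - X ^ (4 * i + 1) - X ^ (4 * i + 4), by ring⟩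

theorem natAbs_le_schurExponent (m : ℤ) : m.natAbs ≤ (m * (5 * m - 1) / 2).toNat := by
  have h := schurExponent_spec m
  have h2 : 2 * |m| ≤ m * (5 * m - 1) := by
    rcases abs_cases m with ⟨h, _⟩ | ⟨h, _⟩
    · rcases eq_or_ne m 0 with rfl | h0
      · simp
      · have : 1 ≤ m := by omega
        rw [h]; nlinarith
    · have : m ≤ -1 := by omega
      rw [h]; nlinarith
  have := Int.natCast_natAbs m
  omega

theorem X_pow_natAbs_dvd_schurTerm (m : ℤ) : X ^ m.natAbs ∣ schurTerm m :=
  (pow_dvd_pow _ (natAbs_le_schurExponent m)).mul_left _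

theorem summable_schurTerm : Summable schurTerm :=
  summable_of_X_pow_dvd finite_natAbs_le X_pow_natAbs_dvd_schurTerm

theorem X_pow_dvd_sumTerm (k : ℕ) : X ^ id k ∣ sumTerm k :=
  (pow_dvd_pow _ (Nat.le_self_pow two_ne_zero k)).mul_right _

theorem summable_sumTerm : Summable sumTerm :=
  summable_of_X_pow_dvd Set.finite_le_nat X_pow_dvd_sumTerm

/-- Taking the limit along `ℤ` allows composition with `N ± j`, `2N` and `5N`. -/
theorem tendsto_invPoch {k : ℕ} (hk : k ≠ 0) :
    Tendsto (invPoch k) atTop (𝓝 (∏' i, eulerFactor (k * (i + 1)))) := by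
  rw [← Nat.map_cast_int_atTop, tendsto_map'_iff]
  simpa only [Function.comp_def, invPoch_natCast] using
    (multipliable_eulerFactor hk).tendsto_prod_tprod_nat

theorem tsum_sumTerm : ∑' k, sumTerm k = 1 + ∑' k, sumTerm (k + 1) := by
  rw [summable_sumTerm.tsum_eq_zero_add, sumTerm_eq,
    Nat.cast_zero, (isInvPochhammer_invPoch one_ne_zero).zero]
  simp

/-- The inverse is `∏ (1 - t^(k(i+1)))`. Used to cancel the surplus factors after taking limits. -/
theorem isUnit_tprod_eulerFactor {k : ℕ} (hk : k ≠ 0) :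
    IsUnit (∏' i, eulerFactor (k * (i + 1))) := by
  have h : Multipliable fun i => (1 - X ^ (k * (i + 1)) : ℤ⟦X⟧) :=
    multipliable_of_X_pow_dvd fun i => by
      have : 1 * (i + 1) ≤ k * (i + 1) := Nat.mul_le_mul_right _ (Nat.one_le_iff_ne_zero.mpr hk)
      rw [sub_sub_cancel_left]
      exact (pow_dvd_pow _ (by omega)).neg_right
  refine IsUnit.of_mul_eq_one_right (∏' i, (1 - X ^ (k * (i + 1)) : ℤ⟦X⟧)) ?_
  rw [← h.tprod_mul (multipliable_eulerFactor hk)]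
  simp_rw [one_sub_X_pow_mul_eulerFactor (Nat.mul_ne_zero hk (Nat.succ_ne_zero _)), tprod_one]

theorem tendsto_invPoch_natCast_add {k : ℕ} (hk : k ≠ 0) (j : ℤ) :
    Tendsto (fun N : ℕ => invPoch k (N + j)) atTop (𝓝 (∏' i, eulerFactor (k * (i + 1)))) :=
  (tendsto_invPoch hk).comp
    (tendsto_atTop_add_const_right _ j tendsto_natCast_atTop_atTop)

theorem tendsto_finsum_schurTerm {k : ℕ} (hk : k ≠ 0) :
    Tendsto (fun N : ℕ => ∑ᶠ j : ℤ, schurTerm j * (invPoch k (N - j) * invPoch k (N + j))) atTop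
      (𝓝 ((∑' j, schurTerm j) * (∏' i, eulerFactor (k * (i + 1))) ^ 2)) := by
  have hr := isInvPochhammer_invPoch hk
  rw [sq, ← summable_schurTerm.tsum_mul_right]
  have e (N : ℕ) : ∑ᶠ j : ℤ, schurTerm j * (invPoch k (N - j) * invPoch k (N + j)) =
      ∑' j : ℤ, schurTerm j * (invPoch k (N - j) * invPoch k (N + j)) :=
    (tsum_eq_finsum ((Finset.finite_toSet _).subset (hr.support_subset _ N))).symm
  simp_rw [e]
  refine tendsto_tsum_of_X_pow_dvd finite_natAbs_le
    (fun N j => (X_pow_natAbs_dvd_schurTerm j).mul_right _) fun j => ?_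
  exact ((tendsto_invPoch_natCast_add hk (-j)).mul (tendsto_invPoch_natCast_add hk j)).const_mul _

theorem tsum_sumTerm_eq_mul :
    ∑' k, sumTerm k = (∏' i, eulerFactor (i + 1)) * ∑' m, schurTerm m := by
  have hr := isInvPochhammer_invPoch one_ne_zero
  have hlim := tendsto_finsum_schurTerm one_ne_zero
  have e (N : ℕ) : ∑ᶠ j : ℤ, schurTerm j * (invPoch 1 (N - j) * invPoch 1 (N + j)) =
      ∑' s : ℕ, X ^ (s ^ 2) * invPoch 1 (N - s) * invPoch 1 s := by
    have h := hr.schur_finite N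
    simp only [pow_one] at h
    rw [tsum_eq_sum (s := Finset.range (N + 1)), ← h]
    · exact finsum_eq_sum_of_support_subset _ (hr.support_subset _ N)
    · intro s hs
      rw [hr.neg (N - s) (by simp at hs; omega), mul_zero, zero_mul]
  simp_rw [e] at hlim
  have hlim' := tendsto_tsum_of_X_pow_dvd (h := id)
    (F := fun (N s : ℕ) => X ^ (s ^ 2) * invPoch 1 (N - s) * invPoch 1 s)
    (f := fun s => X ^ (s ^ 2) * (∏' i, eulerFactor (1 * (i + 1))) * invPoch 1 s)
    Set.finite_le_nat
    (fun N s => ((pow_dvd_pow _ (Nat.le_self_pow two_ne_zero s)).mul_right _).mul_right _)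
    (fun s => ((tendsto_invPoch_natCast_add one_ne_zero (-s)).const_mul _).mul_const _)
  have key := tendsto_nhds_unique hlim hlim'
  simp_rw [mul_right_comm _ (∏' i, eulerFactor (1 * (i + 1))), ← sumTerm_eq] at key
  rw [summable_sumTerm.tsum_mul_right, sq, ← mul_assoc] at key
  have := (isUnit_tprod_eulerFactor one_ne_zero).mul_right_cancel key
  simpa only [one_mul, mul_comm] using this.symm

theorem tprod_prodFactor_eq_mul :
    ∏' i, prodFactor i = (∏' i, eulerFactor (i + 1)) * ∑' m, schurTerm m := by
  have h5 : (5 : ℕ) ≠ 0 := by norm_num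
  have e (N : ℕ) : invPoch 5 (2 * N) * (invPoch 5 N * ∏ k ∈ Finset.range N, prodFactor k) =
      invPoch 1 (5 * N) *
        ∑ᶠ j : ℤ, schurTerm j * (invPoch 5 (N - j) * invPoch 5 (N + j)) := by
    rw [invPoch_mul_prod_prodFactor, finsum_schurTerm]
    ring
  have hmul (c : ℤ) (hc : 0 < c) : Tendsto (fun N : ℕ => c * (N : ℤ)) atTop atTop :=
    tendsto_natCast_atTop_atTop.const_mul_atTop' hc
  have l1 := ((tendsto_invPoch h5).comp (hmul 2 (by norm_num))).mul
    (((tendsto_invPoch h5).comp tendsto_natCast_atTop_atTop).mul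
      multipliable_prodFactor.tendsto_prod_tprod_nat)
  have l2 := ((tendsto_invPoch one_ne_zero).comp (hmul 5 (by norm_num))).mul
    (tendsto_finsum_schurTerm h5)
  have key := tendsto_nhds_unique (l1.congr e) l2
  refine ((isUnit_tprod_eulerFactor h5).pow 2).mul_left_cancel ?_
  simp only [one_mul] at key
  linear_combination key

end Limits

/-! ### Generating functions of partitions -/

section Partitions

theorem eulerFactor_eq_tsum {m : ℕ} (hm : m ≠ 0) : eulerFactor m = ∑' j : ℕ, X ^ (m * j) := by
  have h := one_sub_mul_tsum_pow_of_constantCoeff_eq_zero (f := (X ^ m : ℤ⟦X⟧)) (by simp [hm])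
  simp_rw [← pow_mul] at h
  exact (eq_recip (constantCoeff_one_sub_X_pow hm) h).symm

theorem P_eq_tprod : P = ∏' i, eulerFactor (i + 1) := by
  have h := Nat.Partition.powerSeriesMk_card_restricted_eq_tprod ℤ (fun _ => True)
  simp only [if_true, ← eulerFactor_eq_tsum (Nat.succ_ne_zero _)] at h
  rw [← h]
  simp [P, Nat.Partition.restricted]

/-- Multisets of `k` natural numbers with sum `n`. -/
def multisets (k n : ℕ) : Set (Multiset ℕ) := {s | s.card = k ∧ s.sum = n}

theorem finite_multisets (k n : ℕ) : (multisets k n).Finite := by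
  refine (((Finset.range (n + 1)).sym k).finite_toSet.image (fun s : Sym ℕ k => (s : Multiset ℕ))).subset ?_
  rintro s ⟨hk, hn⟩
  refine ⟨Sym.mk s hk, Finset.mem_sym_iff.mpr fun a ha => ?_, rfl⟩
  rw [Finset.mem_range, Nat.lt_succ_iff, ← hn]
  exact Multiset.le_sum_of_mem ha

theorem image_map_add_multisets (k n m : ℕ) :
    Multiset.map (· + m) '' multisets k n =
      {s | s.card = k ∧ s.sum = n + k * m ∧ ∀ a ∈ s, m ≤ a} := by
  ext s
  constructor
  · rintro ⟨s, ⟨hk, hn⟩, rfl⟩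
    refine ⟨by simpa using hk, ?_, ?_⟩
    · simp [Multiset.sum_map_add, hk, hn]
    · intro a ha
      obtain ⟨b, _, rfl⟩ := Multiset.mem_map.mp ha
      exact Nat.le_add_left m b
  · rintro ⟨hk, hn, hm⟩
    have hs : (s.map (· - m)).map (· + m) = s := by
      rw [Multiset.map_map]
      conv_rhs => rw [← Multiset.map_id s]
      exact Multiset.map_congr rfl fun a ha => Nat.sub_add_cancel (hm a ha)
    refine ⟨s.map (· - m), ⟨by simpa using hk, ?_⟩, hs⟩
    have h2 := congrArg Multiset.sum hs
    rw [Multiset.sum_map_add, hn] at h2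
    simpa [hk] using h2

theorem ncard_multisets_bounded_below (k n m : ℕ) :
    {s : Multiset ℕ | s.card = k ∧ s.sum = n ∧ ∀ a ∈ s, m ≤ a}.ncard =
      if k * m ≤ n then (multisets k (n - k * m)).ncard else 0 := by
  split_ifs with h
  · rw [← Set.ncard_image_of_injective (multisets k _) (Multiset.map_injective (add_left_injective m)),
      image_map_add_multisets, Nat.sub_add_cancel h]
  · rw [Set.ncard_eq_zero ((finite_multisets k n).subset fun s hs => ⟨hs.1, hs.2.1⟩),
      Set.eq_empty_iff_forall_notMem]
    rintro s ⟨hk, hn, hm⟩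
    have := Multiset.card_nsmul_le_sum hm
    rw [hk, hn, smul_eq_mul] at this
    exact h this

/-- Either `0` occurs and one copy is removed, or all elements are positive and `1` is subtracted
from each. -/
theorem ncard_multisets_succ (k n : ℕ) :
    (multisets (k + 1) n).ncard =
      (multisets k n).ncard + if k + 1 ≤ n then (multisets (k + 1) (n - (k + 1))).ncard else 0 := by
  have h : multisets (k + 1) n = Multiset.cons 0 '' multisets k n ∪
      {s : Multiset ℕ | s.card = k + 1 ∧ s.sum = n ∧ ∀ a ∈ s, 1 ≤ a} := by
    ext s
    constructor
    · rintro ⟨hk, hn⟩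
      by_cases h0 : 0 ∈ s
      · obtain ⟨t, rfl⟩ := Multiset.exists_cons_of_mem h0
        exact Or.inl ⟨t, ⟨by simpa using hk, by simpa using hn⟩, rfl⟩
      · exact Or.inr ⟨hk, hn, fun a ha => Nat.one_le_iff_ne_zero.mpr fun h => h0 (h ▸ ha)⟩
    · rintro (⟨t, ⟨hk, hn⟩, rfl⟩ | ⟨hk, hn, _⟩)
      · exact ⟨by simp [hk], by simp [hn]⟩
      · exact ⟨hk, hn⟩
  have hb := ncard_multisets_bounded_below (k + 1) n 1
  rw [mul_one] at hb
  rw [h, Set.ncard_union_eq ?_ ((finite_multisets k n).image _)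
      ((finite_multisets (k + 1) n).subset fun s hs => ⟨hs.1, hs.2.1⟩), hb,
    Set.ncard_image_of_injective _ fun _ _ => (Multiset.cons_inj_right 0).mp]
  rw [Set.disjoint_left]
  rintro _ ⟨t, _, rfl⟩ ⟨_, _, h1⟩
  exact absurd (h1 0 (Multiset.mem_cons_self 0 t)) (by omega)

/-- The counting recursion says that multiplying by `1 - t^(k+1)` lowers `k + 1` to `k`, which is
the recursion of `invPoch 1`. -/
theorem mk_ncard_multisets (k : ℕ) :
    (PowerSeries.mk fun n => ((multisets k n).ncard : ℤ)) = invPoch 1 k := by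
  have hr := isInvPochhammer_invPoch one_ne_zero
  induction k with
  | zero =>
    rw [Nat.cast_zero, hr.zero]
    ext n
    rw [coeff_mk, coeff_one]
    split_ifs with h
    · have : multisets 0 n = {0} := by
        ext s
        simp only [multisets, Set.mem_ofPred_eq, Multiset.card_eq_zero, Set.mem_singleton_iff, h]
        exact ⟨fun h => h.1, fun h => by simp [h]⟩
      simp [this]
    · have : multisets 0 n = ∅ := by
        rw [Set.eq_empty_iff_forall_notMem]
        rintro s ⟨hs, hn⟩
        rw [Multiset.card_eq_zero.mp hs] at hn
        exact h hn.symm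
      simp [this]
  | succ k ih =>
    have hs := hr.succ k
    refine (hr.isUnit k).mul_left_cancel ?_
    push_cast
    rw [hs, ← ih, pow_one, sub_mul, one_mul]
    ext n
    rw [map_sub, coeff_X_pow_mul', coeff_mk, coeff_mk, ncard_multisets_succ]
    split_ifs <;> simp

theorem card_isRogersRamanujan (n : ℕ) :
    Nat.card {p : n.Partition // IsRogersRamanujan p} =
      ∑ k ∈ Finset.range (n + 1),
        if k ^ 2 ≤ n then (multisets k (n - k ^ 2)).ncard else 0 := by
  classical
  rw [Nat.card_eq_fintype_card, Fintype.card_subtype,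
    Finset.card_eq_sum_card_fiberwise (f := fun p : n.Partition => p.parts.card)
      (t := Finset.range (n + 1))]
  · refine Finset.sum_congr rfl fun k _ => ?_
    rw [sq, ← ncard_multisets_bounded_below, ← Set.ncard_coe_finset,
      ← Set.ncard_image_of_injective _ (f := Nat.Partition.parts)
        fun _ _ h => Nat.Partition.ext h]
    congr 1
    ext s
    simp only [Finset.coe_filter, Finset.mem_filter, Finset.mem_univ, true_and, Set.mem_image,
      Set.mem_ofPred_eq]
    constructor
    · rintro ⟨p, ⟨hp, rfl⟩, rfl⟩
      exact ⟨rfl, p.parts_sum, hp⟩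
    · rintro ⟨hk, hn, hm⟩
      -- An element exists, so `k ≥ 1`, and every element is at least `k`.
      have hpos {a : ℕ} (ha : a ∈ s) : 0 < a :=
        lt_of_lt_of_le (hk ▸ Multiset.card_pos_iff_exists_mem.mpr ⟨a, ha⟩) (hm a ha)
      exact ⟨⟨s, hpos, hn⟩, ⟨fun a ha => hk.symm ▸ hm a ha, hk⟩, rfl⟩
  · intro p _
    have h := Multiset.card_nsmul_le_sum (s := p.parts) (a := 1) fun a ha => p.parts_pos ha
    rw [p.parts_sum] at h
    simp only [Finset.coe_range, Set.mem_Iio]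
    simp at h
    omega

theorem Q_eq_tsum : Q = ∑' k, sumTerm k := by
  ext n
  rw [coeff_tsum_of_X_pow_dvd Set.finite_le_nat X_pow_dvd_sumTerm, Q, coeff_mk, card_isRogersRamanujan]
  push_cast
  refine Finset.sum_congr (by ext; simp) fun k _ => ?_
  rw [sumTerm_eq, coeff_X_pow_mul', ← mk_ncard_multisets]
  split_ifs <;> simp

end Partitions

end RogersRamanujan

/-- The first Rogers–Ramanujan identity and Schur's identity, in `ℤ⟦t⟧` with the topology of
coefficientwise convergence (`ℤ` discrete); all infinite sums and products converge. -/
theorem mainTheorem1 :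
    -- convergence of the infinite sums and products
    (Summable fun k : ℕ => RogersRamanujan.sumTerm (k + 1)) ∧
    (Multipliable fun i : ℕ => RogersRamanujan.prodFactor i) ∧
    (Multipliable fun i : ℕ => RogersRamanujan.eulerFactor (i + 1)) ∧
    (Summable fun m : ℤ => RogersRamanujan.schurTerm m) ∧
    -- the first Rogers–Ramanujan identity
    (1 + ∑' k : ℕ, RogersRamanujan.sumTerm (k + 1) =
      ∏' i : ℕ, RogersRamanujan.prodFactor i) ∧
    -- Schur's identity
    (1 + ∑' k : ℕ, RogersRamanujan.sumTerm (k + 1) =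
      (∏' i : ℕ, RogersRamanujan.eulerFactor (i + 1)) *
        ∑' m : ℤ, RogersRamanujan.schurTerm m) ∧
    -- the two sides of Schur's identity as generating functions of partitions
    (RogersRamanujan.P = ∏' i : ℕ, RogersRamanujan.eulerFactor (i + 1)) ∧
    (RogersRamanujan.Q = 1 + ∑' k : ℕ, RogersRamanujan.sumTerm (k + 1)) ∧
    (RogersRamanujan.Q = RogersRamanujan.P * ∑' m : ℤ, RogersRamanujan.schurTerm m) := by
  have hs := RogersRamanujan.tsum_sumTerm
  have hm := RogersRamanujan.multipliable_eulerFactor one_ne_zero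
  simp only [one_mul] at hm
  refine ⟨(summable_nat_add_iff 1).mpr RogersRamanujan.summable_sumTerm,
    RogersRamanujan.multipliable_prodFactor, hm, RogersRamanujan.summable_schurTerm,
    ?_, ?_, RogersRamanujan.P_eq_tprod, ?_, ?_⟩
  · rw [← hs, RogersRamanujan.tsum_sumTerm_eq_mul, RogersRamanujan.tprod_prodFactor_eq_mul]
  · rw [← hs, RogersRamanujan.tsum_sumTerm_eq_mul]
  · rw [← hs, RogersRamanujan.Q_eq_tsum]
  · rw [RogersRamanujan.Q_eq_tsum, RogersRamanujan.tsum_sumTerm_eq_mul,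
      RogersRamanujan.P_eq_tprod]
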